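/- Let $\mathbb F_q$ be a finite field with $q$ elements, and let $m,n\ge 1$ be integers with $m\le\lceil n/2\rceil$. Let $W=\{0\}\times\mathbb F_q^{n}\le\mathbb F_q^{m}\times\mathbb F_q^{n}=\mathbb F_q^{m+n}$, and identify each matrix $A\in\mathbb F_q^{m\times n}$ with the $m$-dimensional subspace $\{(x,xA): x\in\mathbb F_q^m\}$ (the row space of $[I\mid A]$), which meets $W$ trivially. Call a family $\mathcal F\subseteq\mathbb F_q^{m\times n}$ *intersecting* if $A-B$ does not have full rank, i.e. $\operatorname{rank}(A-B)\ne m$, for all $A,B\in\mathcal F$. Call $\mathcal F$ *canonically intersecting* if there is a $1$-dimensional subspace $\ell\le\mathbb F_q^{m+n}$ with $\ell\cap W=0$ such that $\mathcal F$ is the set of all matrices $A\in\mathbb F_q^{m\times n}$ whose associated subspace contains $\ell$. **Theorem.** If $\mathcal F\subseteq\mathbb F_q^{m\times n}$ is intersecting, then $|\mathcal F|\le q^{(m-1)n}$. Moreover, equality holds if and only if $\mathcal F$ is canonically intersecting. -/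

import Mathlib

namespace BilinearForms

/-- A family of `m × n` matrices is intersecting if `A - B` is not of full rank
for all members `A`, `B`. -/
def IsIntersecting {K : Type*} [Field K] {m n : ℕ}
    (𝓕 : Set (Matrix (Fin m) (Fin n) K)) : Prop :=
  ∀ A ∈ 𝓕, ∀ B ∈ 𝓕, (A - B).rank ≠ min m n

/-- The fixed `n`-dimensional subspace `W = 0 × K^n` of `K^m × K^n`. -/
def fixedSubspace (K : Type*) [Field K] (m n : ℕ) :
    Submodule K ((Fin m → K) × (Fin n → K)) :=
  Submodule.prod ⊥ ⊤

/-- An `m × n` matrix `A` viewed as an `m`-dimensional subspace of `K^m × K^n` skew to `W`: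
the row space of the block matrix `[I | A]`, i.e. the set of all `(x, x A)`. -/
def toSubspace {K : Type*} [Field K] {m n : ℕ} (A : Matrix (Fin m) (Fin n) K) :
    Submodule K ((Fin m → K) × (Fin n → K)) :=
  A.vecMulLinear.graph

/-- A family is canonically intersecting if it consists of all matrices which, as subspaces,
contain a fixed `1`-dimensional subspace `ℓ` skew to `W`. -/
def IsCanonicallyIntersecting {K : Type*} [Field K] {m n : ℕ}
    (𝓕 : Set (Matrix (Fin m) (Fin n) K)) : Prop :=
  ∃ ℓ : Submodule K ((Fin m → K) × (Fin n → K)),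
    Module.finrank K ℓ = 1 ∧ Disjoint ℓ (fixedSubspace K m n) ∧
      𝓕 = {A | ℓ ≤ toSubspace A}

end BilinearForms

/-! Identify `K^n` with the field `L` of degree `n` over `K`: a matrix becomes a vector in `L^m`, of
full rank iff its coordinates are `K`-independent. Nonzero multiples of an independent `r` stay
independent, so an intersecting family meets each coset of the line `L r` at most once. This gives
the bound; at equality every such coset is met (`exists_add_smul_mem`).

Suppose an extremal family lies in no hyperplane over `K` through one of its members. Some member
`a` has a missing neighbour `a + t e_j`; then most `a + t e_j` are missing, and cosets through them
yield many members `b` with `b - a` independent off `j` (`le_card_independent_off`). But such `b`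
lie in `q^(m-1)` hyperplanes through `a`, and a member outside each one confines its members to few
subspaces of codimension two (`card_independent_off_mul_le`). For `n ≥ 2m - 1` these counts clash.
-/

namespace BilinearForms

open Finset Module

/-! ### Counting solutions of linear equations -/

section Counting

variable {ι K V : Type*} [Fintype ι] [DecidableEq ι] [Field K]
  [AddCommGroup V] [Module K V] [Fintype V] [DecidableEq V]

theorem card_fiber_mul_card {G H : Type*} [AddGroup G] [Fintype G] [AddGroup H] [Fintype H]
    [DecidableEq H] (φ : G →+ H) (hφ : Function.Surjective φ) (c : H) :
    #{g | φ g = c} * Fintype.card H = Fintype.card G := by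
  have h := Finset.card_eq_sum_card_fiberwise (f := φ) (s := univ) (t := univ) (by simp)
  rw [Finset.card_univ] at h
  rw [h, Finset.sum_congr rfl fun d _ =>
    AddMonoidHom.card_fiber_eq_of_mem_range φ (hφ d) (hφ c)]
  simp [mul_comm]

theorem card_hyperplane {k : ℕ} (hk : Fintype.card ι = k + 1) {x : ι → K} (hx : x ≠ 0) (c : V) :
    #{b : ι → V | ∑ i, x i • b i = c} = Fintype.card V ^ k := by
  obtain ⟨j, hj⟩ := Function.ne_iff.mp hx
  let φ : (ι → V) →+ V :=
    { toFun := fun b => ∑ i, x i • b i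
      map_zero' := by simp
      map_add' := by simp [Finset.sum_add_distrib] }
  have hφ : Function.Surjective φ := fun v => by
    refine ⟨Pi.single j ((x j)⁻¹ • v), ?_⟩
    change ∑ i, x i • (Pi.single j ((x j)⁻¹ • v) : ι → V) i = v
    rw [Finset.sum_eq_single j (by simp +contextual) (by simp)]
    simp [smul_inv_smul₀ hj]
  have h := card_fiber_mul_card φ hφ c
  rw [Fintype.card_fun, hk, pow_succ] at h
  exact Nat.eq_of_mul_eq_mul_right Fintype.card_pos h

theorem card_inter_hyperplanes {k : ℕ} (hk : Fintype.card ι = k + 2) {x z : ι → K} {j : ι}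
    (hx : x j = 1) (hz : ∀ t : K, t • x ≠ z) (c d : V) :
    #{b : ι → V | ∑ i, x i • b i = c ∧ ∑ i, z i • b i = d} = Fintype.card V ^ k := by
  -- Since `x j = 1`, this makes the minor of `x`, `z` in columns `j`, `l` nonzero.
  obtain ⟨l, hl⟩ := Function.ne_iff.mp (hz (z j))
  have hl' : z l - z j * x l ≠ 0 := sub_ne_zero.mpr fun h => hl (by simp [h])
  let φ : (ι → V) →+ V × V :=
    { toFun := fun b => (∑ i, x i • b i, ∑ i, z i • b i)
      map_zero' := by simp
      map_add' := by simp [Finset.sum_add_distrib] }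
  have hs (y : ι → K) (m : ι) (v : V) : ∑ i, y i • (Pi.single m v : ι → V) i = y m • v := by
    rw [Finset.sum_eq_single m (by simp +contextual) (by simp)]
    simp
  have hφ : Function.Surjective φ := fun ⟨c, d⟩ => by
    set v := (z l - z j * x l)⁻¹ • (d - z j • c) with hv
    have hv' : (z l - z j * x l) • v = d - z j • c := smul_inv_smul₀ hl' _
    refine ⟨Pi.single l v + Pi.single j (c - x l • v), ?_⟩
    change (∑ i, x i • (Pi.single l v + Pi.single j (c - x l • v) : ι → V) i,
      ∑ i, z i • (Pi.single l v + Pi.single j (c - x l • v) : ι → V) i) = (c, d)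
    simp only [Pi.add_apply, smul_add, Finset.sum_add_distrib, hs, hx]
    refine Prod.ext (by simp) ?_
    rw [sub_smul, sub_eq_iff_eq_add] at hv'
    simp only [hv', smul_sub, smul_smul]
    abel
  have h := card_fiber_mul_card φ hφ (c, d)
  rw [Fintype.card_fun, Fintype.card_prod, hk, pow_add, sq] at h
  have h2 := Nat.eq_of_mul_eq_mul_right (Nat.mul_pos Fintype.card_pos Fintype.card_pos) h
  rw [← h2]
  congr 1
  ext b
  simp [φ, Prod.ext_iff]

variable [Fintype K] [DecidableEq K]

theorem card_coord_eq_one {k : ℕ} (hk : Fintype.card ι = k + 1) (j : ι) :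
    #{x : ι → K | x j = 1} = Fintype.card K ^ k := by
  rw [← card_hyperplane (K := K) hk (x := Pi.single j 1) (by simp) 1]
  congr 1
  ext x
  simp [Pi.single_apply]

/-- The nonzero scalar multiples of a nonzero vector. -/
theorem card_nonzero_multiples {W : Type*} [AddCommGroup W] [Module K W] [DecidableEq W] {z : W}
    (hz : z ≠ 0) : #(((univ : Finset K).erase 0).image fun t => t • z) = Fintype.card K - 1 := by
  rw [Finset.card_image_of_injective _ (smul_left_injective K hz)]
  simp

-- Double count of pairs `(v, x)` with `x ≠ 0` a relation of `v`: the relations of a dependent `v`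
-- include all nonzero multiples of one.
open Classical in
theorem card_dependent_le {k : ℕ} (hk : Fintype.card ι = k + 1) :
    #{v : ι → V | ¬ LinearIndependent K v} * (Fintype.card K - 1) ≤
      (Fintype.card K ^ (k + 1) - 1) * Fintype.card V ^ k := by
  have ht : #((univ : Finset (ι → K)).erase 0) = Fintype.card K ^ (k + 1) - 1 := by simp [hk]
  rw [← ht]
  refine Finset.card_mul_le_card_mul (fun v x => ∑ i, x i • v i = 0) (fun v hv => ?_)
    fun x hx => ?_
  · obtain ⟨g, hg, i, hi⟩ := Fintype.not_linearIndependent_iff.mp (by simpa using hv)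
    have hg0 : g ≠ 0 := fun h => hi (by simp [h])
    rw [← card_nonzero_multiples (K := K) hg0]
    refine Finset.card_le_card fun y hy => ?_
    obtain ⟨t, ht, rfl⟩ := Finset.mem_image.mp hy
    have ht0 : t ≠ 0 := by simpa using ht
    simp [Finset.bipartiteAbove, ht0, hg0, mul_smul, ← Finset.smul_sum, hg]
  · rw [← card_hyperplane (V := V) hk (by simpa using hx : x ≠ 0) 0]
    exact Finset.card_le_card fun v hv => by
      simpa using (Finset.mem_filter.mp hv).2

end Counting

/-! ### Linear independence over the smaller field -/

section Independence

variable {ι K L : Type*} [Fintype ι] [DecidableEq ι] [Field K] [Field L] [Algebra K L]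

theorem linearIndependent_smul {κ : Type*} {v : κ → L} (hv : LinearIndependent K v) {t : L}
    (ht : t ≠ 0) : LinearIndependent K (t • v) :=
  hv.map' (LinearMap.mulLeft K t) (LinearMap.ker_eq_bot.mpr (mul_right_injective₀ ht))

theorem exists_coord_eq_one_of_dependent {j : ι} {b : ι → L} (hb : ¬ LinearIndependent K b)
    (hj : LinearIndependent K fun i : {i // i ≠ j} => b i) :
    ∃ x : ι → K, x j = 1 ∧ ∑ i, x i • b i = 0 := by
  obtain ⟨g, hg, i, hi⟩ := Fintype.not_linearIndependent_iff.mp hb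
  have hgj : g j ≠ 0 := fun h => by
    rw [Fintype.sum_eq_add_sum_subtype_ne _ j, h, zero_smul, zero_add] at hg
    have := Fintype.linearIndependent_iff.mp hj (fun i => g i) hg
    by_cases hij : i = j
    · exact hi (hij ▸ h)
    · exact hi (this ⟨i, hij⟩)
  refine ⟨(g j)⁻¹ • g, by simp [hgj], ?_⟩
  simp [mul_smul, ← Finset.smul_sum, hg]

theorem exists_independent_lift [FiniteDimensional K L] (hcard : Fintype.card ι ≤ finrank K L)
    {j : ι} {v : {i // i ≠ j} → L} (hv : LinearIndependent K v) :
    ∃ r : ι → L, LinearIndependent K r ∧ ∀ i : {i // i ≠ j}, r i = v i := by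
  have hlt : finrank K (Submodule.span K (Set.range v)) < finrank K L := by
    rw [finrank_span_eq_card hv]
    have : Fintype.card {i // i ≠ j} < Fintype.card ι := Fintype.card_subtype_lt (x := j) (by simp)
    omega
  obtain ⟨t, ht⟩ : ∃ t, t ∉ Submodule.span K (Set.range v) := by
    by_contra! h
    rw [(Submodule.eq_top_iff'.mpr h : Submodule.span K (Set.range v) = ⊤), finrank_top] at hlt
    exact lt_irrefl _ hlt
  refine ⟨_, (hv.option ht).comp _ (Equiv.optionSubtypeNe j).symm.injective, fun i => ?_⟩
  simp [Equiv.optionSubtypeNe_symm_of_ne i.2]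

end Independence

theorem exists_independent {ι K L : Type*} [Fintype ι] [Field K] [Field L] [Algebra K L]
    [FiniteDimensional K L] (hcard : Fintype.card ι ≤ finrank K L) :
    ∃ r : ι → L, LinearIndependent K r := by
  obtain ⟨f⟩ : Nonempty (ι ↪ Fin (finrank K L)) :=
    Function.Embedding.nonempty_of_card_le (by simpa using hcard)
  exact ⟨_, (finBasis K L).linearIndependent.comp f f.injective⟩

/-! ### Size bound and local structure of extremal families -/

section Extremal

theorem mk_injOn_of_independent {ι K L : Type*} [Field K] [Field L] [Algebra K L]
    {F : Finset (ι → L)} (hF : ∀ a ∈ F, ∀ b ∈ F, ¬ LinearIndependent K (a - b))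
    {r : ι → L} (hr : LinearIndependent K r) :
    Set.InjOn (Submodule.Quotient.mk (p := Submodule.span L {r})) (F : Set (ι → L)) := by
  intro a ha b hb hab
  obtain ⟨t, ht⟩ := Submodule.mem_span_singleton.mp ((Submodule.Quotient.eq _).mp hab)
  by_contra hne
  refine hF a ha b hb (ht ▸ linearIndependent_smul hr fun h0 => hne ?_)
  rwa [h0, zero_smul, eq_comm, sub_eq_zero] at ht

variable {ι K L : Type*} [Fintype ι] [DecidableEq ι] [Field K] [Field L] [Algebra K L]
  {F : Finset (ι → L)}

variable [Fintype L]

theorem card_quotient_span_singleton {k : ℕ} (hk : Fintype.card ι = k + 1) {r : ι → L}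
    (hr : r ≠ 0) : Nat.card ((ι → L) ⧸ Submodule.span L {r}) = Fintype.card L ^ k := by
  have h := Submodule.card_eq_card_quotient_mul_card (Submodule.span L {r})
  rw [← Nat.card_congr (LinearEquiv.toSpanNonzeroSingleton L (ι → L) r hr).toEquiv,
    Nat.card_eq_fintype_card (α := ι → L), Nat.card_eq_fintype_card (α := L), Fintype.card_fun, hk,
    pow_succ, mul_comm] at h
  exact (Nat.eq_of_mul_eq_mul_left Fintype.card_pos h).symm

theorem card_le_of_intersecting {k : ℕ} (hk : Fintype.card ι = k + 1)
    (hF : ∀ a ∈ F, ∀ b ∈ F, ¬ LinearIndependent K (a - b))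
    {r : ι → L} (hr : LinearIndependent K r) : #F ≤ Fintype.card L ^ k := by
  classical
  have hr0 : r ≠ 0 := by
    obtain ⟨i⟩ : Nonempty ι := Fintype.card_pos_iff.mp (by omega)
    exact fun h => hr.ne_zero i (congrFun h i)
  have := Fintype.ofFinite ((ι → L) ⧸ Submodule.span L {r})
  rw [← card_quotient_span_singleton hk hr0, Nat.card_eq_fintype_card,
    ← Finset.card_image_of_injOn (mk_injOn_of_independent hF hr)]
  exact Finset.card_le_univ _

theorem exists_add_smul_mem {k : ℕ} (hk : Fintype.card ι = k + 1)
    (hF : ∀ a ∈ F, ∀ b ∈ F, ¬ LinearIndependent K (a - b)) (hcard : #F = Fintype.card L ^ k)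
    {r : ι → L} (hr : LinearIndependent K r) (b : ι → L) : ∃ t : L, b + t • r ∈ F := by
  classical
  have hr0 : r ≠ 0 := by
    obtain ⟨i⟩ : Nonempty ι := Fintype.card_pos_iff.mp (by omega)
    exact fun h => hr.ne_zero i (congrFun h i)
  have := Fintype.ofFinite ((ι → L) ⧸ Submodule.span L {r})
  have himg : F.image (Submodule.Quotient.mk (p := Submodule.span L {r})) = univ := by
    rw [← Finset.card_eq_iff_eq_univ, Finset.card_image_of_injOn (mk_injOn_of_independent hF hr),
      hcard, ← card_quotient_span_singleton hk hr0, Nat.card_eq_fintype_card]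
  obtain ⟨a, ha, hab⟩ := Finset.mem_image.mp
    (himg ▸ Finset.mem_univ (Submodule.Quotient.mk b) : Submodule.Quotient.mk b ∈ _)
  obtain ⟨t, ht⟩ := Submodule.mem_span_singleton.mp ((Submodule.Quotient.eq _).mp hab)
  exact ⟨t, by rwa [ht, add_sub_cancel]⟩

/-- Closure under changing one coordinate at a time forces everything. -/
theorem eq_univ_of_single_closed (hne : F.Nonempty)
    (h : ∀ a ∈ F, ∀ (j : ι) (t : L), a + Pi.single j t ∈ F) : F = univ := by
  obtain ⟨a, ha⟩ := hne
  refine Finset.eq_univ_of_forall fun b => ?_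
  have key (s : Finset ι) : a + ∑ i ∈ s, Pi.single i ((b - a) i) ∈ F := by
    induction s using Finset.induction_on with
    | empty => simpa using ha
    | insert i s hi ih =>
      rw [Finset.sum_insert hi, add_comm (Pi.single _ _), ← add_assoc]
      exact h _ ih _ _
  have := key univ
  rwa [Finset.univ_sum_single, add_sub_cancel] at this

theorem exists_add_single_notMem {k : ℕ} (hk : Fintype.card ι = k + 1)
    (hcard : #F = Fintype.card L ^ k) :
    ∃ a ∈ F, ∃ (j : ι) (t : L), a + Pi.single j t ∉ F := by
  by_contra! h
  have hL : 1 < Fintype.card L := Fintype.one_lt_card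
  have hne : F.Nonempty := Finset.card_pos.mp (hcard ▸ pow_pos (by omega) k)
  rw [eq_univ_of_single_closed hne h, Finset.card_univ, Fintype.card_fun, hk] at hcard
  exact (Nat.pow_lt_pow_right hL (Nat.lt_succ_self k)).ne' hcard

variable [DecidableEq L]

-- Double count: the coset through a missing `a + t e_j` along a lift of `v` contains a member `b`,
-- with multiplier `μ ≠ 0`. Conversely `b` and `μ` recover `(v, t)`.
open Classical in
theorem le_card_independent_off {k : ℕ} (hk : Fintype.card ι = k + 1)
    (hF : ∀ a ∈ F, ∀ b ∈ F, ¬ LinearIndependent K (a - b)) (hcard : #F = Fintype.card L ^ k)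
    (hrank : Fintype.card ι ≤ finrank K L) (a : ι → L) (j : ι) :
    #{v : {i // i ≠ j} → L | LinearIndependent K v} * #{t | a + Pi.single j t ∉ F} ≤
      #{b ∈ F | LinearIndependent K fun i : {i // i ≠ j} => b i - a i} *
        (Fintype.card L - 1) := by
  -- One lift is fixed per `v` (0 as a dummy value), so that `v` and `μ` determine `t`.
  have hex (v : {i // i ≠ j} → L) : ∃ r : ι → L, LinearIndependent K v →
      LinearIndependent K r ∧ ∀ i : {i // i ≠ j}, r i = v i := by
    by_cases hv : LinearIndependent K v
    · obtain ⟨r, hr⟩ := exists_independent_lift hrank hv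
      exact ⟨r, fun _ => hr⟩
    · exact ⟨0, fun h => absurd h hv⟩
  choose r hr using hex
  rw [← Finset.card_product, ← mul_one (#(_ ×ˢ _))]
  refine Finset.card_mul_le_card_mul
    (fun p b => ∃ μ : L, μ ≠ 0 ∧ b = a + Pi.single j p.2 + μ • r p.1) (fun p hp => ?_)
    fun b hb => ?_
  · obtain ⟨hv, ht⟩ : LinearIndependent K p.1 ∧ a + Pi.single j p.2 ∉ F := by simpa using hp
    obtain ⟨hri, hrv⟩ := hr _ hv
    obtain ⟨μ, hμ⟩ := exists_add_smul_mem hk hF hcard hri (a + Pi.single j p.2)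
    have hμ0 : μ ≠ 0 := fun h => ht (by simpa [h] using hμ)
    refine Finset.card_pos.mpr ⟨_, Finset.mem_filter.mpr
      ⟨Finset.mem_filter.mpr ⟨hμ, ?_⟩, μ, hμ0, rfl⟩⟩
    convert linearIndependent_smul hv hμ0 using 1
    funext i
    simp [i.2, hrv]
  · have hc : #((univ : Finset L).erase 0) = Fintype.card L - 1 := by simp
    rw [← hc]
    let v (μ : L) (i : {i // i ≠ j}) : L := μ⁻¹ * (b i - a i)
    refine (Finset.card_le_card fun p hp => ?_).trans (Finset.card_image_le
      (f := fun μ : L => (v μ, b j - a j - μ * r (v μ) j)))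
    obtain ⟨hp, μ, hμ0, hbμ⟩ := Finset.mem_filter.mp hp
    have hv : LinearIndependent K p.1 := by simpa using (Finset.mem_product.mp hp).1
    have hvμ : v μ = p.1 := by
      funext i
      simp [v, hbμ, i.2, (hr _ hv).2, hμ0]
    refine Finset.mem_image.mpr ⟨μ, by simpa using hμ0, Prod.ext hvμ ?_⟩
    simp only [hvμ]
    simp only [hbμ, Pi.add_apply, Pi.single_eq_same, Pi.smul_apply, smul_eq_mul]
    ring

variable [Fintype K] [DecidableEq K]

/-- A member `a + t e_j + μ r` differs from each `a + s e_j` by a vector independent off `j`. Their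
relation, normalised to 1 at `j`, determines `s`. -/
theorem card_add_single_mem_le {k : ℕ} (hk : Fintype.card ι = k + 1)
    (hF : ∀ a ∈ F, ∀ b ∈ F, ¬ LinearIndependent K (a - b)) (hcard : #F = Fintype.card L ^ k)
    {r : ι → L} (hr : LinearIndependent K r) {a : ι → L} {j : ι} {t : L}
    (ht : a + Pi.single j t ∉ F) :
    #{s | a + Pi.single j s ∈ F} ≤ Fintype.card K ^ k := by
  obtain ⟨μ, hμ⟩ := exists_add_smul_mem hk hF hcard hr (a + Pi.single j t)
  have hμ0 : μ ≠ 0 := fun h => ht (by simpa [h] using hμ)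
  rw [← card_coord_eq_one (K := K) hk j]
  refine (Finset.card_le_card fun s hs => ?_).trans
    (Finset.card_image_le (f := fun x : ι → K => t + ∑ i, x i • (μ * r i)))
  have hs' : a + Pi.single j s ∈ F := by simpa using hs
  obtain ⟨x, hx, hsum⟩ := exists_coord_eq_one_of_dependent (j := j) (hF _ hμ _ hs') (by
    convert linearIndependent_smul (hr.comp (fun i : {i // i ≠ j} => (i : ι))
      Subtype.val_injective) hμ0 using 1
    funext i
    simp [i.2])
  refine Finset.mem_image.mpr ⟨x, by simpa using hx, ?_⟩
  have h1 (i : ι) : (a + Pi.single j t + μ • r - (a + Pi.single j s) : ι → L) i =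
      (Pi.single j (t - s) : ι → L) i + μ * r i := by
    simp only [Pi.sub_apply, Pi.add_apply, Pi.smul_apply, smul_eq_mul, Pi.single_sub]
    ring
  have h2 : ∑ i, x i • (Pi.single j (t - s) : ι → L) i = t - s := by
    rw [Finset.sum_eq_single j (by simp +contextual) (by simp)]
    simp [hx]
  simp only [h1, smul_add, Finset.sum_add_distrib, h2] at hsum
  linear_combination hsum

/-- An intersecting family that is not contained in a given affine hyperplane defined over the
smaller field has few members in it. -/
theorem card_filter_hyperplane_le {k : ℕ} (hk : Fintype.card ι = k + 2)
    (hF : ∀ a ∈ F, ∀ b ∈ F, ¬ LinearIndependent K (a - b)) {x : ι → K} {j : ι} (hx : x j = 1)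
    {a c : ι → L} (hc : c ∈ F) (hac : ∑ i, x i • (c i - a i) ≠ 0) :
    #{b ∈ F | ∑ i, x i • (b i - a i) = 0} * (Fintype.card K - 1) ≤
      (Fintype.card K ^ (k + 2) - Fintype.card K) * Fintype.card L ^ k := by
  have hx0 : x ≠ 0 := fun h => by simp [h] at hx
  have ht : #((univ : Finset (ι → K)) \ univ.image fun t : K => t • x) =
      Fintype.card K ^ (k + 2) - Fintype.card K := by
    rw [Finset.card_sdiff_of_subset (Finset.subset_univ _),
      Finset.card_image_of_injective _ (smul_left_injective K hx0)]
    simp [hk]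
  rw [← ht]
  refine Finset.card_mul_le_card_mul (fun b z => ∑ i, z i • (b i - c i) = 0) (fun b hb => ?_)
    fun z hz => ?_
  · obtain ⟨hbF, hb⟩ := Finset.mem_filter.mp hb
    obtain ⟨g, hg, i, hi⟩ := Fintype.not_linearIndependent_iff.mp (hF b hbF c hc)
    simp only [Pi.sub_apply] at hg
    have hg0 : g ≠ 0 := fun h => hi (by simp [h])
    -- A relation of `b - c` proportional to `x` would put `c` in the hyperplane.
    have hgx (s : K) : s • x ≠ g := by
      rintro rfl
      have hs0 : s ≠ 0 := fun h => hg0 (by simp [h])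
      simp only [Pi.smul_apply, smul_eq_mul, mul_smul, ← Finset.smul_sum] at hg
      have hg' := (smul_eq_zero.mp hg).resolve_left hs0
      apply hac
      simp only [smul_sub, Finset.sum_sub_distrib] at hb hg' ⊢
      linear_combination hb - hg'
    rw [← card_nonzero_multiples (K := K) hg0]
    refine Finset.card_le_card fun y hy => ?_
    obtain ⟨t, ht, rfl⟩ := Finset.mem_image.mp hy
    have ht0 : t ≠ 0 := by simpa using ht
    have hmul (s : K) : s • x ≠ t • g := fun h => hgx (t⁻¹ * s) (by
      rw [mul_smul, h, inv_smul_smul₀ ht0])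
    simp [Finset.bipartiteAbove, hmul, mul_smul, ← Finset.smul_sum, hg]
  · have hz' (t : K) : t • x ≠ z := fun h => (Finset.mem_sdiff.mp hz).2 (by simp [← h])
    rw [← card_inter_hyperplanes (V := L) hk hx hz' (∑ i, x i • a i) (∑ i, z i • c i)]
    refine Finset.card_le_card fun b hb => ?_
    obtain ⟨hb1, hb2⟩ := Finset.mem_filter.mp hb
    have hb3 := (Finset.mem_filter.mp hb1).2
    simp only [smul_sub, Finset.sum_sub_distrib, sub_eq_zero] at hb2 hb3
    simp [hb2, hb3]

end Extremal

-- As `b - a` is dependent, independence off `j` gives a relation with `x j = 1`; a union bound over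
-- these `x` remains.
open Classical in
theorem card_independent_off_mul_le {ι K L : Type*} [Fintype ι] [DecidableEq ι]
    [Field K] [Fintype K] [DecidableEq K] [Field L] [Algebra K L] [DecidableEq L] {F : Finset (ι → L)}
    {k : ℕ} (hk : Fintype.card ι = k + 2)
    (hF : ∀ a ∈ F, ∀ b ∈ F, ¬ LinearIndependent K (a - b)) {a : ι → L} {j : ι}
    {N : ℕ} (hN : ∀ x : ι → K, x j = 1 →
      #{b ∈ F | ∑ i, x i • (b i - a i) = 0} * (Fintype.card K - 1) ≤ N) (ha : a ∈ F) :
    #{b ∈ F | LinearIndependent K fun i : {i // i ≠ j} => b i - a i} * (Fintype.card K - 1) ≤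
      Fintype.card K ^ (k + 1) * N := by
  have hsub : ({b ∈ F | LinearIndependent K fun i : {i // i ≠ j} => b i - a i} : Finset _) ⊆
      ({x : ι → K | x j = 1} : Finset _).biUnion
        fun x => {b ∈ F | ∑ i, x i • (b i - a i) = 0} := by
    intro b hb
    obtain ⟨hbF, hb⟩ := Finset.mem_filter.mp hb
    obtain ⟨x, hx, hsum⟩ := exists_coord_eq_one_of_dependent (hF b hbF a ha) hb
    simp only [Finset.mem_biUnion, Finset.mem_filter, Finset.mem_univ, true_and]
    exact ⟨x, hx, hbF, hsum⟩
  calc _ ≤ (∑ x : ι → K with x j = 1, #{b ∈ F | ∑ i, x i • (b i - a i) = 0}) *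
        (Fintype.card K - 1) :=
        Nat.mul_le_mul_right _ ((Finset.card_le_card hsub).trans Finset.card_biUnion_le)
    _ ≤ ∑ x : ι → K with x j = 1, N := by
        rw [Finset.sum_mul]
        exact Finset.sum_le_sum fun x hx => hN x (by simpa using hx)
    _ = _ := by rw [Finset.sum_const, card_coord_eq_one (k := k + 1) hk j, smul_eq_mul]

/-- The numerical contradiction behind the classification of extremal families. -/
theorem counting_contradiction {q a Q R G I s : ℤ} (hq : 2 ≤ q) (ha : 1 ≤ a) (hR : 1 ≤ R)
    (hQ : q * a ^ 2 ≤ Q) (hs : s ≤ a)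
    (hI : R * ((q - 1) * Q - (a - 1)) ≤ (q - 1) * I)
    (hGI : I * (Q - s) ≤ G * (Q - 1)) (hG : G * (q - 1) ≤ a * ((q * a - q) * R)) : False := by
  -- In the application `a = q^(k+1)`, `Q = |L|`, `R = |L|^k`, and `s` counts the members `a + s
  -- e_j`.
  have haQ : a ≤ Q := by nlinarith
  have h1 : R * ((q - 1) * Q - (a - 1)) * (Q - a) ≤ R * (a * (q * a - q) * (Q - 1)) := by
    have hI0 : 0 ≤ (q - 1) * I := le_trans (mul_nonneg (by omega) (by nlinarith)) hI
    calc R * ((q - 1) * Q - (a - 1)) * (Q - a) ≤ (q - 1) * I * (Q - a) :=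
          mul_le_mul_of_nonneg_right hI (by omega)
      _ ≤ (q - 1) * I * (Q - s) := mul_le_mul_of_nonneg_left (by omega) hI0
      _ = (q - 1) * (I * (Q - s)) := by ring
      _ ≤ (q - 1) * (G * (Q - 1)) := mul_le_mul_of_nonneg_left hGI (by omega)
      _ = G * (q - 1) * (Q - 1) := by ring
      _ ≤ a * ((q * a - q) * R) * (Q - 1) := mul_le_mul_of_nonneg_right hG (by omega)
      _ = _ := by ring
  rw [mul_assoc] at h1
  have h2 := le_of_mul_le_mul_left h1 (by omega)
  -- Expansion of `h2`. By `q a² ≤ Q` and `q ≥ 2`, the left side is at least `Q > 0`.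
  have h3 : Q * ((q - 1) * Q - q * a ^ 2 + 1) + (a - 1) * (q + 1) * a ≤ 0 := by
    nlinarith
  have h4 : 0 ≤ (q - 2) * Q := mul_nonneg (by omega) (by omega)
  have h5 : 1 ≤ (q - 1) * Q - q * a ^ 2 + 1 := by nlinarith
  have h6 : 0 ≤ (a - 1) * (q + 1) * a := by
    exact mul_nonneg (mul_nonneg (by omega) (by omega)) (by omega)
  nlinarith

/-! ### Extremal families lie in a hyperplane -/

section Classification

variable {ι K L : Type*} [Fintype ι] [DecidableEq ι] [Field K] [Field L] [Algebra K L]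
  [Fintype L] [DecidableEq L] {F : Finset (ι → L)} [Fintype K] [DecidableEq K]

/-- An intersecting family of maximum size lies in an affine hyperplane defined over the
smaller field. -/
theorem exists_hyperplane_of_card_eq {k : ℕ} (hk : Fintype.card ι = k + 1)
    (hrank : 2 * k + 1 ≤ finrank K L)
    (hF : ∀ a ∈ F, ∀ b ∈ F, ¬ LinearIndependent K (a - b)) (hcard : #F = Fintype.card L ^ k) :
    ∃ a ∈ F, ∃ x : ι → K, x ≠ 0 ∧ ∀ b ∈ F, ∑ i, x i • (b i - a i) = 0 := by
  classical
  obtain _ | k := k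
  · obtain ⟨a, rfl⟩ := Finset.card_eq_one.mp (by simpa using hcard)
    obtain ⟨j⟩ : Nonempty ι := Fintype.card_pos_iff.mp (by omega)
    exact ⟨a, by simp, Pi.single j 1, by simp, by simp⟩
  by_contra! h
  obtain ⟨a, ha, j, t, ht⟩ := exists_add_single_notMem hk hcard
  obtain ⟨r, hr⟩ := exists_independent (ι := ι) (K := K) (L := L) (by omega)
  have hκ : Fintype.card {i // i ≠ j} = k + 1 := by
    rw [Fintype.card_subtype_compl, Fintype.card_subtype_eq, hk]
    omega
  have hs := card_add_single_mem_le hk hF hcard hr ht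
  have hns := Finset.card_filter_add_card_filter_not (s := univ)
    fun s => a + Pi.single j s ∈ F
  have hdep := card_dependent_le (K := K) (V := L) hκ
  have hI := Finset.card_filter_add_card_filter_not (s := univ)
    fun v : {i // i ≠ j} → L => LinearIndependent K v
  have hGI := le_card_independent_off hk hF hcard (by omega) a j
  have hG := card_independent_off_mul_le (j := j) hk hF (fun x hx => by
    obtain ⟨c, hc, hac⟩ := h a ha x fun h0 => by simp [h0] at hx
    exact card_filter_hyperplane_le hk hF hx hc hac) ha
  rw [Finset.card_univ] at hns hI
  rw [Fintype.card_fun, hκ] at hI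
  -- Here `m = k + 2`, so the exponent is `2k + 3 = 2m - 1 ≤ n`.
  have hQ : Fintype.card K * (Fintype.card K ^ (k + 1)) ^ 2 ≤ Fintype.card L := by
    rw [Module.card_eq_pow_finrank (K := K) (V := L), ← pow_mul, ← pow_succ']
    exact Nat.pow_le_pow_right Fintype.card_pos (by omega)
  have hq : 2 ≤ Fintype.card K := Fintype.one_lt_card
  have hLpos : 1 ≤ Fintype.card L := Fintype.card_pos
  have hR : 1 ≤ Fintype.card L ^ k := Nat.one_le_pow _ _ hLpos
  have ha1 : 1 ≤ Fintype.card K ^ (k + 1) := Nat.one_le_pow _ _ (by omega)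
  have hqa : Fintype.card K ^ (k + 2) = Fintype.card K * Fintype.card K ^ (k + 1) := pow_succ' _ _
  have hle : Fintype.card K ≤ Fintype.card K * Fintype.card K ^ (k + 1) :=
    Nat.le_mul_of_pos_right _ ha1
  rw [hqa] at hG
  rw [pow_succ (Fintype.card L)] at hI
  generalize Fintype.card K ^ (k + 1) = A at *
  generalize Fintype.card L ^ k = R at *
  generalize Fintype.card K = q at *
  generalize Fintype.card L = Q at *
  generalize #{v : {i // i ≠ j} → L | LinearIndependent K v} = I at *
  generalize #{b ∈ F | LinearIndependent K fun i : {i // i ≠ j} => b i - a i} = G at *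
  generalize #{s | a + Pi.single j s ∈ F} = s at *
  generalize #{s | a + Pi.single j s ∉ F} = s' at *
  generalize #{v : {i // i ≠ j} → L | ¬ LinearIndependent K v} = D at *
  zify [hLpos, ha1, hle, (by omega : 1 ≤ q)] at hGI hG hdep hI hns hQ hs hq hR
  refine counting_contradiction hq (by exact_mod_cast ha1) hR hQ hs (I := I) (G := G) ?_ ?_ hG
  · nlinarith
  · rwa [← hns, add_sub_cancel_left, hns]

end Classification

/-! ### Canonical families as solution sets, and the theorem -/

/-- For `ℓ` spanned by `(x, y)`, being skew to `W` means `x ≠ 0`, and lying in the graph of `A`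
means `x A = y`. -/
theorem isCanonicallyIntersecting_iff {K : Type*} [Field K] {m n : ℕ}
    {𝓕 : Set (Matrix (Fin m) (Fin n) K)} :
    IsCanonicallyIntersecting 𝓕 ↔
      ∃ x : Fin m → K, x ≠ 0 ∧ ∃ y : Fin n → K, 𝓕 = {A | Matrix.vecMul x A = y} := by
  have hle (x : Fin m → K) (y : Fin n → K) (A : Matrix (Fin m) (Fin n) K) :
      Submodule.span K {(x, y)} ≤ toSubspace A ↔ Matrix.vecMul x A = y := by
    rw [Submodule.span_singleton_le_iff_mem, toSubspace, LinearMap.mem_graph_iff]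
    exact eq_comm
  have hdisj (x : Fin m → K) (y : Fin n → K) (hxy : (x, y) ≠ 0) :
      Disjoint (Submodule.span K {(x, y)}) (fixedSubspace K m n) ↔ x ≠ 0 := by
    rw [disjoint_comm, Submodule.disjoint_span_singleton' hxy]
    simp [fixedSubspace]
  constructor
  · rintro ⟨ℓ, hℓ, hd, h⟩
    obtain ⟨⟨⟨x, y⟩, hmem⟩, hne, hspan⟩ := finrank_eq_one_iff'.mp hℓ
    have hxy : (x, y) ≠ 0 := fun h0 => hne (Subtype.ext h0)
    obtain rfl : Submodule.span K {(x, y)} = ℓ := by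
      refine le_antisymm ((Submodule.span_singleton_le_iff_mem _ _).mpr hmem) fun w hw => ?_
      obtain ⟨t, ht⟩ := hspan ⟨w, hw⟩
      exact Submodule.mem_span_singleton.mpr ⟨t, congrArg Subtype.val ht⟩
    exact ⟨x, (hdisj x y hxy).mp hd, y, by simpa only [hle] using h⟩
  · rintro ⟨x, hx, y, h⟩
    have hxy : (x, y) ≠ 0 := fun h0 => hx (congrArg Prod.fst h0)
    exact ⟨Submodule.span K {(x, y)}, finrank_span_singleton hxy, (hdisj x y hxy).mpr hx,
      by simpa only [hle] using h⟩

theorem card_vecMul_eq {K : Type*} [Field K] [Fintype K] [DecidableEq K] {k n : ℕ}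
    {x : Fin (k + 1) → K} (hx : x ≠ 0) (y : Fin n → K) :
    #{A : Matrix (Fin (k + 1)) (Fin n) K | Matrix.vecMul x A = y} = Fintype.card K ^ (k * n) := by
  have h := card_hyperplane (V := Fin n → K) (Fintype.card_fin (k + 1)) hx y
  rw [Fintype.card_fun, Fintype.card_fin, ← pow_mul, mul_comm n k] at h
  rw [← h]
  simp only [Matrix.vecMul_eq_sum]
  rfl

end BilinearForms

theorem mainTheorem9 {K : Type*} [Field K] [Fintype K] (m n : ℕ) (hm : 1 ≤ m)
    (hmn : m ≤ ⌈(n : ℚ) / 2⌉₊) (𝓕 : Finset (Matrix (Fin m) (Fin n) K))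
    (h𝓕 : BilinearForms.IsIntersecting (𝓕 : Set (Matrix (Fin m) (Fin n) K))) :
    𝓕.card ≤ Fintype.card K ^ ((m - 1) * n) ∧
      (𝓕.card = Fintype.card K ^ ((m - 1) * n) ↔
        BilinearForms.IsCanonicallyIntersecting (𝓕 : Set (Matrix (Fin m) (Fin n) K))) := by
  classical
  obtain ⟨k, rfl⟩ : ∃ k, m = k + 1 := ⟨m - 1, by omega⟩
  rw [Nat.add_sub_cancel]
  have hn : 2 * k + 1 ≤ n := by
    have h := Nat.lt_ceil.mp (Nat.lt_of_succ_le hmn)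
    rw [lt_div_iff₀ two_pos] at h
    have : k * 2 < n := by exact_mod_cast h
    omega
  obtain ⟨p, _⟩ := CharP.exists K
  have : Fact p.Prime := ⟨CharP.char_is_prime K p⟩
  have : NeZero n := ⟨by omega⟩
  let L := FiniteField.Extension K p n
  have : Fintype L := Fintype.ofFinite L
  have hfr : Module.finrank K L = n := FiniteField.finrank_extension K p n
  let e : (Fin n → K) ≃ₗ[K] L := LinearEquiv.ofFinrankEq _ _ (by simp [hfr])
  let E : Matrix (Fin (k + 1)) (Fin n) K → Fin (k + 1) → L := fun A i => e (A i)
  have hE : Function.Injective E := fun A B h => by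
    funext i
    exact e.injective (congrFun h i)
  have hF : ∀ a ∈ 𝓕.image E, ∀ b ∈ 𝓕.image E, ¬ LinearIndependent K (a - b) := by
    simp only [Finset.forall_mem_image]
    intro A hA B hB h
    refine h𝓕 A hA B hB ?_
    have hrow : LinearIndependent K (A - B).row := by
      refine LinearIndependent.of_comp e.toLinearMap ?_
      convert h using 1
      funext i
      exact map_sub e (A i) (B i)
    rw [hrow.rank_matrix, Fintype.card_fin]
    omega
  have hLK : Fintype.card L ^ k = Fintype.card K ^ (k * n) := by
    rw [Module.card_eq_pow_finrank (K := K) (V := L), hfr, ← pow_mul, mul_comm]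
  have hcard : (𝓕.image E).card = 𝓕.card := Finset.card_image_of_injective _ hE
  refine ⟨?_, fun h => ?_, fun h => ?_⟩
  · obtain ⟨r, hr⟩ := BilinearForms.exists_independent (ι := Fin (k + 1)) (K := K) (L := L)
      (by rw [hfr, Fintype.card_fin]; omega)
    rw [← hcard, ← hLK]
    exact BilinearForms.card_le_of_intersecting (Fintype.card_fin _) hF hr
  · obtain ⟨a, ha, x, hx, hb⟩ := BilinearForms.exists_hyperplane_of_card_eq
      (Fintype.card_fin (k + 1)) (by rwa [hfr]) hF (by rw [hcard, h, hLK])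
    obtain ⟨A, hA, rfl⟩ := Finset.mem_image.mp ha
    rw [BilinearForms.isCanonicallyIntersecting_iff]
    refine ⟨x, hx, Matrix.vecMul x A, ?_⟩
    -- As `x` has entries in `K`, the hyperplane equation descends through `e`; equal cardinalities
    -- then turn inclusion into equality.
    have hsub : 𝓕 ⊆ ({B | Matrix.vecMul x B = Matrix.vecMul x A} : Finset _) := fun B hB => by
      have hBA := hb _ (Finset.mem_image_of_mem E hB)
      simp only [E, ← map_sub, ← map_smul, ← map_sum] at hBA
      rw [e.map_eq_zero_iff] at hBA
      simp only [smul_sub, Finset.sum_sub_distrib, sub_eq_zero] at hBA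
      simpa [Matrix.vecMul_eq_sum] using hBA
    rw [Finset.eq_of_subset_of_card_le hsub (by rw [BilinearForms.card_vecMul_eq hx, h])]
    simp
  · obtain ⟨x, hx, y, h⟩ := BilinearForms.isCanonicallyIntersecting_iff.mp h
    rw [← BilinearForms.card_vecMul_eq hx y]
    congr 1
    ext A
    simpa using Set.ext_iff.mp h A
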